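/- Let $(E,d)$ be a metric space and, for $x\in E$, let $F(\cdot,x)$ be the conditional distribution function of a real response $Y$ given the covariate value $x$. Let $q(\alpha,x)>0$ satisfy $F(q(\alpha,x),x)=1-\alpha$ for all $\alpha\in(0,1)$ and $x\in E$. Fix $t\in E$ and $\gamma(t)>0$, and assume that $\alpha\mapsto q(\alpha,t)$ is differentiable on $(0,1)$ and that $\Delta(\alpha,t)=\gamma(t)+\alpha\,\frac{\partial\log q}{\partial\alpha}(\alpha,t)$ is a real-valued continuous function of $\alpha\in(0,1)$ with $\Delta(\alpha,t)\to0$ as $\alpha\to0$. For each $n$ let $Y_1,\dots,Y_n$ be independent, $Y_i$ having distribution function $F(\cdot,x_i)$, where $x_1,\dots,x_n\in E$ are non-random design points (both may depend on $n$). Let $h_n>0$ with $h_n\to0$, let $B(t,h_n)=\{x\in E: d(x,t)\le h_n\}$, let $m=m_n$ be the number of $i\le n$ with $x_i\in B(t,h_n)$, and let $Z_{1,m}\le\dots\le Z_{m,m}$ be the ordered values of those $Y_i$ with $x_i\in B(t,h_n)$. For $a\in(0,1/2)$ put $$\omega_n(a)=\sup\Big\{\Big|\log\frac{q(\alpha,x)}{q(\alpha,x')}\Big|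 : \alpha\in(a,1-a),\ x,x'\in B(t,h_n)\Big\}\in[0,\infty].$$ Let $\alpha_n\in(0,1)$ satisfy $\alpha_n\to0$, $m_n\alpha_n\to c\in[1,\infty)$ and $\lfloor m_n\alpha_n\rfloor\to\lfloor c\rfloor$ (where $\lfloor\cdot\rfloor$ is the integer part), and let $\hat q_1(\alpha_n,t)=Z_{m-\lfloor m\alpha_n\rfloor+1,\,m}$ (which is well defined for $n$ large). If $\omega_n\big(m_n^{-(1+\delta)}\big)\to0$ for some $\delta>0$, then $$\frac{\hat q_1(\alpha_n,t)}{q(\alpha_n,t)}-1\ \xrightarrow{d}\ \mathcal E(c,\gamma(t)),$$ where $\mathcal E(c,\gamma(t))$ is a non-degenerate probability distribution on $\mathbb R$ (that is, not a point mass) that depends only on $c$ and $\gamma(t)$. In particular $\hat q_1(\alpha_n,t)$ is not consistent: $\hat q_1(\alpha_n,t)/q(\alpha_n,t)$ does not converge to $1$ in probability. -/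

import Mathlib

open MeasureTheory ProbabilityTheory Filter Set
open scoped Topology ENNReal

namespace ExtremeQuantile

noncomputable section

/-- The function `Δ(α) = γ + α * (d/dα) log Q(α)` attached to a quantile function `Q` and a
tail index `γ`. -/
def Delta (Q : ℝ → ℝ) (γ : ℝ) (α : ℝ) : ℝ :=
  γ + α * deriv (fun a => Real.log (Q a)) α

/-- The regularity assumption on the quantile function `Q = q(·, t)` with tail index `γ = γ(t)`:
`Q` is positive and differentiable on `(0, 1)`, and `Δ` is continuous on `(0, 1)` with
`Δ(α) → 0` as `α → 0`. -/
structure AssumptionA (Q : ℝ → ℝ) (γ : ℝ) : Prop where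
  pos : ∀ α ∈ Ioo (0 : ℝ) 1, 0 < Q α
  differentiable : ∀ α ∈ Ioo (0 : ℝ) 1, DifferentiableAt ℝ Q α
  continuousOn_Delta : ContinuousOn (Delta Q γ) (Ioo (0 : ℝ) 1)
  tendsto_Delta : Tendsto (Delta Q γ) (𝓝[>] 0) (𝓝 0)

variable {E : Type*} [MetricSpace E]

/-- The largest oscillation of the log-quantile function in its second variable:
the supremum of `|log (q(α, x) / q(α, x'))|` over `α ∈ (a, 1 - a)` and `x, x'` in the closed
ball of centre `t` and radius `h`.  It takes values in `[0, ∞]`. -/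
def oscillation (q : ℝ → E → ℝ) (t : E) (h a : ℝ) : ℝ≥0∞ :=
  ⨆ α ∈ Ioo a (1 - a), ⨆ x ∈ Metric.closedBall t h, ⨆ x' ∈ Metric.closedBall t h,
    ENNReal.ofReal |Real.log (q α x / q α x')|

open Classical in
/-- The indices of the design points lying in the closed ball of centre `t` and radius `h`. -/
def slice {n : ℕ} (x : Fin n → E) (t : E) (h : ℝ) : Finset (Fin n) :=
  Finset.univ.filter (fun i => x i ∈ Metric.closedBall t h)

/-- The number `m_t` of design points in the closed ball of centre `t` and radius `h`. -/
def sliceCard {n : ℕ} (x : Fin n → E) (t : E) (h : ℝ) : ℕ := (slice x t h).card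

/-- The `j`-th order statistic (`j = 1` is the smallest, `j = s.card` the largest) of the values
`z i`, `i ∈ s`; it is given the value `0` when `j > s.card`. -/
def orderStat {ι : Type*} (s : Finset ι) (z : ι → ℝ) (j : ℕ) : ℝ :=
  ((s.val.map z).sort (· ≤ ·)).getD (j - 1) 0

/-- The estimator `Z_{m - ⌊m α⌋ + 1, m}` of the conditional quantile of order `1 - α` at `t`, where
`Z_{1,m} ≤ … ≤ Z_{m,m}` are the ordered responses `y i` whose design point `x i` is in the closed
ball of centre `t` and radius `h`. -/
def qHat {n : ℕ} (x : Fin n → E) (t : E) (h α : ℝ) (y : Fin n → ℝ) : ℝ :=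
  orderStat (slice x t h) y
    (sliceCard x t h - ⌊(sliceCard x t h : ℝ) * α⌋₊ + 1)

end

/-- Convergence in probability to the constant `a` of real random variables `X n`, each defined on
a probability space of its own. -/
def ConvergesInProbability {Ω : ℕ → Type*} [∀ n, MeasurableSpace (Ω n)]
    (P : ∀ n, Measure (Ω n)) (X : ∀ n, Ω n → ℝ) (a : ℝ) : Prop :=
  ∀ ε : ℝ, 0 < ε → Tendsto (fun n => P n {ω | ε ≤ |X n ω - a|}) atTop (𝓝 0)

end ExtremeQuantile

namespace ExtremeQuantile

/-! With k = ⌊mα⌋, the estimator is at most z exactly when fewer than k responses in the window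
exceed z (`qHat_le_iff`). Take z = r^(-γ) q(α_n, t). Since Δ → 0, q(·, t) varies regularly at 0 with
exponent -γ, so z is close to q(rα_n, t). The oscillation condition carries this over to q(rα_n, x)
for all x in the ball, because rα_n is of order 1/m, well above m^(-(1+δ)). Each exceedance
therefore has probability about rα_n ~ cr/m, uniformly in the window
(`eventually_exceedance_mem_Icc`), and the number of exceedances is asymptotically Poisson with mean
cr (`tendsto_measureReal_card_filter_lt`).

As k is eventually ⌊c⌋, the distribution functions at r^(-γ) - 1 tend to P(Poisson(cr) < ⌊c⌋) = P(T
> cr), with T of Gamma law of shape ⌊c⌋. This is the distribution function of (T/c)^(-γ) - 1, which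
is not a point mass and charges a half-line to the left of a negative number, whence the
inconsistency. -/

/-! ### Order statistics through exceedance counts. -/

/-- In a sorted list the entries above `y` form a suffix, so everything depends on whether that
suffix starts after position `i`. -/
theorem getElem_le_iff_countP_lt {l : List ℝ} (hl : l.Pairwise (· ≤ ·)) {i : ℕ}
    (hi : i < l.length) (y : ℝ) :
    l[i] ≤ y ↔ i + l.countP (fun v => decide (y < v)) < l.length := by
  rw [List.pairwise_iff_getElem] at hl
  have hmono : ∀ a b (ha : a < l.length) (hb : b < l.length), a ≤ b → l[a] ≤ l[b] := by
    intro a b ha hb hab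
    rcases hab.eq_or_lt with rfl | hab
    · exact le_rfl
    · exact hl a b ha hb hab
  constructor
  · intro h
    have h0 : (l.take (i + 1)).countP (fun v => decide (y < v)) = 0 := by
      rw [List.countP_eq_zero]
      intro v hv
      obtain ⟨a, ha, rfl⟩ := List.mem_iff_getElem.1 hv
      simp only [List.length_take] at ha
      simp only [List.getElem_take, decide_eq_true_eq, not_lt]
      exact (hmono a i (by omega) hi (by omega)).trans h
    have h1 : (l.drop (i + 1)).countP (fun v => decide (y < v)) ≤ (l.drop (i + 1)).length :=
      List.countP_le_length
    have h2 := List.countP_append (p := fun v => decide (y < v)) (l₁ := l.take (i + 1))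
      (l₂ := l.drop (i + 1))
    rw [List.take_append_drop] at h2
    rw [List.length_drop] at h1
    omega
  · intro h
    by_contra! hy
    have h0 : (l.drop i).countP (fun v => decide (y < v)) = (l.drop i).length := by
      rw [List.countP_eq_length]
      intro v hv
      obtain ⟨a, ha, rfl⟩ := List.mem_iff_getElem.1 hv
      simp only [List.length_drop] at ha
      simp only [List.getElem_drop, decide_eq_true_eq]
      exact hy.trans_le (hmono i (i + a) hi (by omega) (by omega))
    have h2 := List.countP_append (p := fun v => decide (y < v)) (l₁ := l.take i)
      (l₂ := l.drop i)
    rw [List.take_append_drop] at h2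
    rw [List.length_drop] at h0
    omega

theorem orderStat_le_iff {ι : Type*} (s : Finset ι) (z : ι → ℝ) {j : ℕ} (hj : j - 1 < s.card)
    (y : ℝ) :
    orderStat s z j ≤ y ↔ j - 1 + (s.filter (fun i => y < z i)).card < s.card := by
  have hlen : ((s.val.map z).sort (· ≤ ·)).length = s.card := by simp
  have hc : ((s.val.map z).sort (· ≤ ·)).countP (fun v => decide (y < v))
      = (s.filter (fun i => y < z i)).card := by
    have h1 : ((s.val.map z).sort (· ≤ ·)).countP (fun v => decide (y < v))
        = Multiset.countP (fun v => y < v) (s.val.map z) := by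
      conv_rhs => rw [← Multiset.sort_eq (s.val.map z) (· ≤ ·)]
      rw [Multiset.coe_countP]
    rw [h1, Multiset.countP_map]
    rfl
  have := getElem_le_iff_countP_lt (Multiset.pairwise_sort (s.val.map z) (· ≤ ·))
    (i := j - 1) (by rw [hlen]; exact hj) y
  rw [hc] at this
  rw [orderStat, List.getD_eq_getElem _ _ (by rw [hlen]; exact hj), this, hlen]

theorem orderStat_of_card_le {ι : Type*} (s : Finset ι) (z : ι → ℝ) {j : ℕ}
    (hj : s.card ≤ j - 1) : orderStat s z j = 0 := by
  rw [orderStat, List.getD_eq_default]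
  simpa using hj

theorem measurable_card_filter_lt {ι : Type*} (s : Finset ι) (y : ℝ) :
    Measurable (fun z : ι → ℝ => (s.filter (fun i => y < z i)).card) := by
  simp only [Finset.card_filter]
  refine Finset.measurable_fun_sum _ fun i _ => ?_
  exact Measurable.ite (measurableSet_lt measurable_const (measurable_pi_apply i))
    measurable_const measurable_const

theorem measurable_orderStat {ι : Type*} (s : Finset ι) (j : ℕ) :
    Measurable (fun z : ι → ℝ => orderStat s z j) := by
  rcases le_or_gt s.card (j - 1) with hj | hj
  · simp only [orderStat_of_card_le s _ hj]
    exact measurable_const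
  · refine measurable_of_Iic fun y => ?_
    have : (fun z : ι → ℝ => orderStat s z j) ⁻¹' Iic y
        = (fun z : ι → ℝ => (s.filter (fun i => y < z i)).card) ⁻¹'
          {N | j - 1 + N < s.card} := by
      ext z
      exact orderStat_le_iff s z hj y
    rw [this]
    exact measurable_card_filter_lt s y (by measurability)

/-! ### Poisson limit for exceedance counts. -/

/-- The law of the number of exceedances of a level by independent variables. -/
theorem measureReal_card_filter_eq {ι Ω : Type*} [MeasurableSpace Ω] [DecidableEq ι]
    {P : Measure Ω} [IsProbabilityMeasure P] {Y : ι → Ω → ℝ} (hY : iIndepFun Y P)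
    (hm : ∀ i, AEMeasurable (Y i) P) (s : Finset ι) (y : ℝ) (j : ℕ) :
    P.real {ω | (s.filter (fun i => y < Y i ω)).card = j}
      = ∑ S ∈ s.powersetCard j,
        (∏ i ∈ S, P.real {ω | y < Y i ω}) * ∏ i ∈ s \ S, (1 - P.real {ω | y < Y i ω}) := by
  classical
  -- Split by the exact set `S` of exceeding indices; each piece is an intersection of independent
  -- events.
  have hset : {ω | (s.filter (fun i => y < Y i ω)).card = j}
      = ⋃ S ∈ s.powersetCard j, {ω | s.filter (fun i => y < Y i ω) = S} := by
    ext ω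
    simp only [mem_ofPred_eq, mem_iUnion, exists_prop, exists_eq_right', Finset.mem_powersetCard,
      Finset.filter_subset, true_and]
  have hinter : ∀ S ∈ s.powersetCard j, {ω | s.filter (fun i => y < Y i ω) = S}
      = ⋂ i ∈ s, Y i ⁻¹' (if i ∈ S then Ioi y else Iic y) := by
    intro S hS
    ext ω
    simp only [mem_ofPred_eq, mem_iInter, mem_preimage]
    have hSs := (Finset.mem_powersetCard.1 hS).1
    constructor
    · rintro rfl i hi
      by_cases h : y < Y i ω
      · simp [hi, h]
      · simp only [Finset.mem_filter, hi, h, and_false, if_false]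
        exact not_lt.1 h
    · intro h
      ext i
      rw [Finset.mem_filter]
      constructor
      · rintro ⟨hi, hy⟩
        by_contra hiS
        have := h i hi
        rw [if_neg hiS] at this
        exact absurd hy (not_lt.2 this)
      · intro hiS
        have := h i (hSs hiS)
        rw [if_pos hiS] at this
        exact ⟨hSs hiS, this⟩
  have hmeas : ∀ (S : Finset ι) i, MeasurableSet (if i ∈ S then Ioi y else Iic y) := by
    intro S i
    split_ifs
    exacts [measurableSet_Ioi, measurableSet_Iic]
  rw [hset, measureReal_biUnion_finset₀]
  · refine Finset.sum_congr rfl fun S hS => ?_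
    have hSs := (Finset.mem_powersetCard.1 hS).1
    rw [hinter S hS, measureReal_def, hY.measure_inter_preimage_eq_mul s (fun i _ => hmeas S i),
      ENNReal.toReal_prod, ← Finset.prod_sdiff hSs, mul_comm]
    congr 1
    · refine Finset.prod_congr rfl fun i hi => ?_
      rw [if_pos hi]
      rfl
    · refine Finset.prod_congr rfl fun i hi => ?_
      rw [if_neg (Finset.mem_sdiff.1 hi).2]
      have : Y i ⁻¹' Iic y = {ω | y < Y i ω}ᶜ := by
        ext ω
        simp
      rw [this, ← measureReal_def, probReal_compl_eq_one_sub₀]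
      exact (hm i).nullMeasurableSet_preimage measurableSet_Ioi
  · intro S _ T _ hST
    refine Disjoint.aedisjoint ?_
    rw [Set.disjoint_left]
    rintro ω h1 h2
    exact hST (h1.symm.trans h2)
  · intro S hS
    rw [hinter S hS]
    exact Finset.nullMeasurableSet_biInter _ fun i _ =>
      (hm i).nullMeasurableSet_preimage (hmeas S i)

/-- Bounding factor by factor replaces unequal probabilities by a binomial-type term, at the cost of
different parameters for successes and failures. -/
theorem sum_powersetCard_prod_le {ι : Type*} [DecidableEq ι] (s : Finset ι) (p : ι → ℝ)
    (j : ℕ) {a b : ℝ} (ha : 0 ≤ a) (hp1 : ∀ i ∈ s, p i ≤ 1)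
    (hp : ∀ i ∈ s, a ≤ p i ∧ p i ≤ b) :
    ∑ S ∈ s.powersetCard j, (∏ i ∈ S, p i) * ∏ i ∈ s \ S, (1 - p i)
      ≤ s.card.choose j * b ^ j * (1 - a) ^ (s.card - j) := by
  rw [← Finset.card_powersetCard, mul_assoc, ← nsmul_eq_mul]
  refine Finset.sum_le_card_nsmul _ _ _ fun S hS => ?_
  obtain ⟨hSs, hcard⟩ := Finset.mem_powersetCard.1 hS
  have h1 : ∏ i ∈ S, p i ≤ b ^ j := by
    rw [← hcard, ← Finset.prod_const]
    exact Finset.prod_le_prod (fun i hi => ha.trans (hp i (hSs hi)).1) fun i hi => (hp i (hSs hi)).2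
  have h2 : ∏ i ∈ s \ S, (1 - p i) ≤ (1 - a) ^ (s.card - j) := by
    rw [← hcard, ← Finset.card_sdiff_of_subset hSs, ← Finset.prod_const]
    refine Finset.prod_le_prod (fun i hi => ?_) fun i hi => ?_
    · linarith [hp1 i (Finset.mem_sdiff.1 hi).1]
    · linarith [(hp i (Finset.mem_sdiff.1 hi).1).1]
  refine mul_le_mul h1 h2 (Finset.prod_nonneg fun i hi => ?_)
    ((Finset.prod_nonneg fun i hi => ha.trans (hp i (hSs hi)).1).trans h1)
  linarith [hp1 i (Finset.mem_sdiff.1 hi).1]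

theorem le_sum_powersetCard_prod {ι : Type*} [DecidableEq ι] (s : Finset ι) (p : ι → ℝ)
    (j : ℕ) {a b : ℝ} (ha : 0 ≤ a) (hb : b ≤ 1)
    (hp : ∀ i ∈ s, a ≤ p i ∧ p i ≤ b) :
    s.card.choose j * a ^ j * (1 - b) ^ (s.card - j) ≤
    ∑ S ∈ s.powersetCard j, (∏ i ∈ S, p i) * ∏ i ∈ s \ S, (1 - p i) := by
  rw [← Finset.card_powersetCard, mul_assoc, ← nsmul_eq_mul]
  refine Finset.card_nsmul_le_sum _ _ _ fun S hS => ?_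
  obtain ⟨hSs, hcard⟩ := Finset.mem_powersetCard.1 hS
  have h1 : a ^ j ≤ ∏ i ∈ S, p i := by
    rw [← hcard, ← Finset.prod_const]
    exact Finset.prod_le_prod (fun i hi => ha) fun i hi => (hp i (hSs hi)).1
  have h2 : (1 - b) ^ (s.card - j) ≤ ∏ i ∈ s \ S, (1 - p i) := by
    rw [← hcard, ← Finset.card_sdiff_of_subset hSs, ← Finset.prod_const]
    refine Finset.prod_le_prod (fun i hi => by linarith) fun i hi => ?_
    linarith [(hp i (Finset.mem_sdiff.1 hi).1).2]
  exact mul_le_mul h1 h2 (pow_nonneg (by linarith) _) ((pow_nonneg ha _).trans h1)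

/-- The parameters `a` and `b` are kept apart to match the factorwise bounds; they merge only when
both tend to `r`. -/
theorem tendsto_choose_mul_pow_mul_one_sub_pow (j : ℕ) (a b : ℝ) :
    Tendsto (fun m : ℕ => (m.choose j : ℝ) * (a / m) ^ j * (1 - b / m) ^ (m - j)) atTop
      (𝓝 (a ^ j / j.factorial * Real.exp (-b))) := by
  have hN : ∀ r : ℝ, Tendsto (fun n : ℕ => (n : ℝ) * (r / n)) atTop (𝓝 r) := by
    intro r
    refine tendsto_const_nhds.congr' ?_
    filter_upwards [eventually_ge_atTop 1] with n hn
    have : (n : ℝ) ≠ 0 := by positivity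
    field_simp
  have hb0 : Tendsto (fun n : ℕ => 1 - b / (n : ℝ)) atTop (𝓝 1) := by
    simpa using (tendsto_const_nhds (x := (1 : ℝ))).sub (tendsto_zero_of_tendsto_mul_atTop (hN b))
  refine (tendsto_choose_mul_pow_atTop j (hN a)).mul ?_
  have h1 : Tendsto (fun n : ℕ => (1 - b / (n : ℝ)) ^ n * ((1 - b / (n : ℝ)) ^ j)⁻¹) atTop
      (𝓝 (Real.exp (-b) * ((1 : ℝ) ^ j)⁻¹)) := by
    refine Tendsto.mul ?_ ((hb0.pow j).inv₀ (by simp))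
    have := Real.tendsto_one_add_pow_exp_of_tendsto (g := fun n : ℕ => -(b / (n : ℝ))) (t := -b)
      (by simpa using (hN b).neg)
    simpa [sub_eq_add_neg] using this
  simp only [one_pow, inv_one, mul_one] at h1
  refine h1.congr' ?_
  filter_upwards [eventually_ge_atTop j, hb0.eventually (Ioi_mem_nhds (zero_lt_one (α := ℝ)))]
    with n hn hpos
  rw [pow_sub₀ _ (ne_of_gt hpos) hn]

/-- The probability that a Poisson variable with mean `r` is smaller than `k`. -/
noncomputable def poissonBelow (k : ℕ) (r : ℝ) : ℝ :=
  ∑ j ∈ Finset.range k, r ^ j / j.factorial * Real.exp (-r)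

/-- A Poisson limit theorem for the number of exceedances by independent, not identically
distributed variables. -/
theorem tendsto_measureReal_card_filter_lt {ι Ω : ℕ → Type*} [∀ n, Finite (ι n)]
    [∀ n, MeasurableSpace (Ω n)]
    {P : ∀ n, Measure (Ω n)} [∀ n, IsProbabilityMeasure (P n)] {Y : ∀ n, ι n → Ω n → ℝ}
    (hY : ∀ n, iIndepFun (Y n) (P n)) (hm : ∀ n i, AEMeasurable (Y n i) (P n))
    (s : ∀ n, Finset (ι n)) (y : ℕ → ℝ) (k : ℕ) {r : ℝ} (hr : 0 < r)
    (hs : Tendsto (fun n => (s n).card) atTop atTop)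
    (hp : ∀ a b : ℝ, 0 < a → a < r → r < b → ∀ᶠ n in atTop, ∀ i ∈ s n,
      a / (s n).card ≤ (P n).real {ω | y n < Y n i ω} ∧
      (P n).real {ω | y n < Y n i ω} ≤ b / (s n).card) :
    Tendsto (fun n => (P n).real {ω | ((s n).filter (fun i => y n < Y n i ω)).card < k}) atTop
      (𝓝 (poissonBelow k r)) := by
  classical
  have hsum : ∀ n, (P n).real {ω | ((s n).filter (fun i => y n < Y n i ω)).card < k}
      = ∑ j ∈ Finset.range k,
        (P n).real {ω | ((s n).filter (fun i => y n < Y n i ω)).card = j} := by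
    intro n
    have hset : {ω | ((s n).filter (fun i => y n < Y n i ω)).card < k}
        = ⋃ j ∈ Finset.range k, {ω | ((s n).filter (fun i => y n < Y n i ω)).card = j} := by
      ext ω
      simp
    rw [hset, measureReal_biUnion_finset₀]
    · intro a _ b _ hab
      refine Disjoint.aedisjoint ?_
      rw [Set.disjoint_left]
      rintro ω h1 h2
      exact hab (h1.symm.trans h2)
    · intro j _
      exact ((measurable_card_filter_lt (s n) (y n)).comp_aemeasurable
        (aemeasurable_pi_lambda (fun ω i => Y n i ω) (hm n))).nullMeasurableSet_preimage
        (measurableSet_singleton j)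
  simp only [hsum]
  refine tendsto_finsetSum _ fun j _ => ?_
  simp only [fun n => measureReal_card_filter_eq (hY n) (hm n) (s n) (y n) j]
  -- The factorwise bounds have limits at `(r - ε, r + ε)` and `(r + ε, r - ε)`; by continuity both
  -- are as close as desired to the Poisson weight.
  have hcont : ContinuousAt (fun x : ℝ × ℝ => x.1 ^ j / j.factorial * Real.exp (-x.2)) (r, r) := by
    fun_prop
  have hl : Tendsto (fun ε : ℝ => (r - ε, r + ε)) (𝓝[>] 0) (𝓝 (r, r)) := by
    have : ContinuousAt (fun ε : ℝ => (r - ε, r + ε)) 0 := by fun_prop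
    simpa [ContinuousAt] using this.tendsto.mono_left nhdsWithin_le_nhds
  have hl' : Tendsto (fun ε : ℝ => (r + ε, r - ε)) (𝓝[>] 0) (𝓝 (r, r)) := by
    have : ContinuousAt (fun ε : ℝ => (r + ε, r - ε)) 0 := by fun_prop
    simpa [ContinuousAt] using this.tendsto.mono_left nhdsWithin_le_nhds
  have hsmall : ∀ᶠ ε : ℝ in 𝓝[>] 0, 0 < ε ∧ ε < r :=
    Ioo_mem_nhdsGT hr
  rw [tendsto_order]
  constructor
  · intro v hv
    obtain ⟨ε, hε, hε0, hεr⟩ := (((hcont.tendsto.comp hl).eventually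
      (lt_mem_nhds hv)).and hsmall).exists
    filter_upwards [hp (r - ε) (r + ε) (by linarith) (by linarith) (by linarith),
      hs.eventually ((tendsto_choose_mul_pow_mul_one_sub_pow j (r - ε) (r + ε)).eventually
        (lt_mem_nhds hε)), hs.eventually (eventually_ge_atTop (⌈r + ε⌉₊ + 1))] with n h1 h2 h3
    refine h2.trans_le (le_sum_powersetCard_prod (s n) _ j ?_ ?_ h1)
    · exact div_nonneg (by linarith) (Nat.cast_nonneg _)
    · have h4 : r + ε ≤ (s n).card :=
        (Nat.le_ceil _).trans (by exact_mod_cast (Nat.le_succ _).trans h3)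
      exact div_le_one_of_le₀ h4 (Nat.cast_nonneg _)
  · intro v hv
    obtain ⟨ε, hε, hε0, hεr⟩ := (((hcont.tendsto.comp hl').eventually
      (gt_mem_nhds hv)).and hsmall).exists
    filter_upwards [hp (r - ε) (r + ε) (by linarith) (by linarith) (by linarith),
      hs.eventually ((tendsto_choose_mul_pow_mul_one_sub_pow j (r + ε) (r - ε)).eventually
        (gt_mem_nhds hε))] with n h1 h2
    refine (sum_powersetCard_prod_le (s n) _ j ?_ (fun i _ => measureReal_le_one) h1).trans_lt h2
    exact div_nonneg (by linarith) (Nat.cast_nonneg _)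

/-! ### Regular variation and exceedance probabilities. -/

/-- The quantile function of index `γ` is regularly varying at `0` with exponent `-γ`. -/
theorem AssumptionA.tendsto_log_sub {Q : ℝ → ℝ} {γ : ℝ} (hQ : AssumptionA Q γ)
    {α : ℕ → ℝ} (hα : ∀ n, 0 < α n) (hα0 : Tendsto α atTop (𝓝 0)) {w : ℝ} (hw : 0 < w) :
    Tendsto (fun n => Real.log (Q (w * α n)) - Real.log (Q (α n))) atTop
      (𝓝 (-γ * Real.log w)) := by
  rw [Metric.tendsto_atTop']
  intro ε hε
  set lo := min 1 w with hlo
  set hi := max 1 w with hhi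
  have hlo0 : 0 < lo := lt_min one_pos hw
  have hhi0 : 0 < hi := lt_max_of_lt_left one_pos
  -- Chosen so that the mean value bound `η / (lo * a) * (hi * a)` equals `ε / 2`.
  set η := ε * lo / (2 * hi) with hη
  have hη0 : 0 < η := by positivity
  have hΔ : ∀ᶠ b in 𝓝[>] (0 : ℝ), |Delta Q γ b| < η := by
    have := hQ.tendsto_Delta.abs
    rw [abs_zero] at this
    exact this.eventually (gt_mem_nhds hη0)
  obtain ⟨ρ, hρ0, hρ⟩ := mem_nhdsGT_iff_exists_Ioo_subset.1 hΔ
  have hρ0 : 0 < ρ := hρ0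
  have hev : ∀ᶠ n in atTop, hi * α n < min ρ 1 := by
    have : Tendsto (fun n => hi * α n) atTop (𝓝 0) := by simpa using hα0.const_mul hi
    exact this.eventually (gt_mem_nhds (lt_min hρ0 one_pos))
  obtain ⟨N, hN⟩ := eventually_atTop.1 hev
  refine ⟨N, fun n hn => ?_⟩
  have hsm := hN n hn.le
  have ha := hα n
  set a := α n
  have hI : ∀ b ∈ Icc (lo * a) (hi * a), 0 < b ∧ b < ρ ∧ b < 1 := fun b hb =>
    ⟨(mul_pos hlo0 ha).trans_le hb.1, hb.2.trans_lt (hsm.trans_le (min_le_left _ _)),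
      hb.2.trans_lt (hsm.trans_le (min_le_right _ _))⟩
  -- Adding `γ * log b` cancels the main term of the derivative and leaves Δ(b)/b.
  have hder : ∀ b ∈ Icc (lo * a) (hi * a),
      HasDerivWithinAt (fun b => Real.log (Q b) + γ * Real.log b) (Delta Q γ b / b)
        (Icc (lo * a) (hi * a)) b := by
    intro b hb
    obtain ⟨h0, _, h1⟩ := hI b hb
    have hd : DifferentiableAt ℝ (fun a => Real.log (Q a)) b :=
      (hQ.differentiable b ⟨h0, h1⟩).log (hQ.pos b ⟨h0, h1⟩).ne'
    have := hd.hasDerivAt.add ((Real.hasDerivAt_log h0.ne').const_mul γ)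
    refine (this.congr_deriv ?_).hasDerivWithinAt
    rw [Delta]
    field_simp
    ring
  have hbound : ∀ b ∈ Icc (lo * a) (hi * a), ‖Delta Q γ b / b‖ ≤ η / (lo * a) := by
    intro b hb
    obtain ⟨h0, h1, _⟩ := hI b hb
    rw [Real.norm_eq_abs, abs_div, abs_of_pos h0]
    exact div_le_div₀ hη0.le (hρ ⟨h0, h1⟩).le (mul_pos hlo0 ha) hb.1
  have hmem1 : a ∈ Icc (lo * a) (hi * a) :=
    ⟨by nlinarith [min_le_left 1 w], by nlinarith [le_max_left 1 w]⟩
  have hmem2 : w * a ∈ Icc (lo * a) (hi * a) :=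
    ⟨by nlinarith [min_le_right 1 w], by nlinarith [le_max_right 1 w]⟩
  have key := (convex_Icc (lo * a) (hi * a)).norm_image_sub_le_of_norm_hasDerivWithin_le
    hder hbound hmem1 hmem2
  have hdist : ‖w * a - a‖ ≤ hi * a := by
    rw [Real.norm_eq_abs, abs_le]
    constructor <;> nlinarith [le_max_left 1 w, le_max_right 1 w]
  rw [Real.dist_eq]
  have hlog : Real.log (w * a) = Real.log w + Real.log a := Real.log_mul hw.ne' ha.ne'
  rw [hlog] at key
  have heq : Real.log (Q (w * a)) + γ * (Real.log w + Real.log a)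
      - (Real.log (Q a) + γ * Real.log a)
      = Real.log (Q (w * a)) - Real.log (Q a) - -γ * Real.log w := by ring
  rw [heq, Real.norm_eq_abs] at key
  calc _ ≤ η / (lo * a) * ‖w * a - a‖ := key
    _ ≤ η / (lo * a) * (hi * a) := by gcongr
    _ = ε / 2 := by rw [hη]; field_simp
    _ < ε := by linarith

variable {E : Type*} [MetricSpace E]

theorem ofReal_abs_log_le_oscillation (q : ℝ → E → ℝ) {t : E} {h a b : ℝ}
    (hb : b ∈ Ioo a (1 - a)) {x x' : E} (hx : x ∈ Metric.closedBall t h)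
    (hx' : x' ∈ Metric.closedBall t h) :
    ENNReal.ofReal |Real.log (q b x / q b x')| ≤ oscillation q t h a :=
  le_iSup₂_of_le b hb (le_iSup₂_of_le x hx (le_iSup₂_of_le x' hx' le_rfl))

/-- Quantiles of order close to `1 - α n`, at points close to `t`, on the logarithmic scale. -/
theorem eventually_abs_log_quantile_lt {t : E} {q : ℝ → E → ℝ} {γ c δ : ℝ}
    (hq : ∀ x : E, ∀ α ∈ Ioo (0 : ℝ) 1, 0 < q α x)
    (hA : AssumptionA (fun α => q α t) γ)
    {h : ℕ → ℝ} (hh : ∀ n, 0 < h n) {m : ℕ → ℕ} (hm : Tendsto m atTop atTop)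
    {α : ℕ → ℝ} (hα : ∀ n, α n ∈ Ioo (0 : ℝ) 1) (hα0 : Tendsto α atTop (𝓝 0)) (hc : 0 < c)
    (hmα : Tendsto (fun n => (m n : ℝ) * α n) atTop (𝓝 c)) (hδ : 0 < δ)
    (hosc : Tendsto (fun n => oscillation q t (h n) ((m n : ℝ) ^ (-(1 + δ)))) atTop (𝓝 0))
    {w ε : ℝ} (hw : 0 < w) (hε : 0 < ε) :
    ∀ᶠ n in atTop, w * α n ∈ Ioo (0 : ℝ) 1 ∧ ∀ x ∈ Metric.closedBall t (h n),
      |Real.log (q (w * α n) x) - Real.log (q (α n) t) + γ * Real.log w| < ε := by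
  have hmR : Tendsto (fun n => (m n : ℝ)) atTop atTop := tendsto_natCast_atTop_atTop.comp hm
  have ha0 : Tendsto (fun n => (m n : ℝ) ^ (-(1 + δ))) atTop (𝓝 0) :=
    (tendsto_rpow_neg_atTop (by linarith)).comp hmR
  have hwα : Tendsto (fun n => w * α n) atTop (𝓝 0) := by simpa using hα0.const_mul w
  have hupper : ∀ᶠ n in atTop, w * α n + (m n : ℝ) ^ (-(1 + δ)) < 1 := by
    have := hwα.add ha0
    rw [add_zero] at this
    exact this.eventually (gt_mem_nhds one_pos)
  -- After multiplication by m, the left side is m^(-δ) → 0 and the right side tends to wc > 0; this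
  -- is where δ > 0 matters.
  have hlower : ∀ᶠ n in atTop, (m n : ℝ) ^ (-(1 + δ)) < w * α n := by
    have h1 : Tendsto (fun n => w * (m n * α n) - (m n : ℝ) ^ (-δ)) atTop (𝓝 (w * c - 0)) :=
      (hmα.const_mul w).sub ((tendsto_rpow_neg_atTop hδ).comp hmR)
    rw [sub_zero] at h1
    filter_upwards [h1.eventually (lt_mem_nhds (mul_pos hw hc)),
      hmR.eventually (eventually_gt_atTop 0)] with n h2 h3
    have h4 : (m n : ℝ) ^ (-δ) = m n * (m n : ℝ) ^ (-(1 + δ)) := by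
      rw [← Real.rpow_one_add' h3.le (by linarith)]
      congr 1
      ring
    rw [h4] at h2
    by_contra! h5
    nlinarith
  have hreg := hA.tendsto_log_sub (fun n => (hα n).1) hα0 hw
  have hreg' : ∀ᶠ n in atTop,
      |Real.log (q (w * α n) t) - Real.log (q (α n) t) + γ * Real.log w| < ε / 2 := by
    have := (hreg.add_const (γ * Real.log w)).abs
    rw [neg_mul, neg_add_cancel, abs_zero] at this
    exact this.eventually (gt_mem_nhds (by linarith))
  have hosc' : ∀ᶠ n in atTop, oscillation q t (h n) ((m n : ℝ) ^ (-(1 + δ)))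
      < ENNReal.ofReal (ε / 2) :=
    hosc.eventually (gt_mem_nhds (ENNReal.ofReal_pos.2 (by linarith)))
  filter_upwards [hupper, hlower, hreg', hosc'] with n h1 h2 h3 h4
  have hpos : 0 < w * α n := mul_pos hw (hα n).1
  have hapos : 0 ≤ (m n : ℝ) ^ (-(1 + δ)) := by positivity
  have hI : w * α n ∈ Ioo (0 : ℝ) 1 := ⟨hpos, by linarith⟩
  refine ⟨hI, fun x hx => ?_⟩
  have h5 := (ofReal_abs_log_le_oscillation q (b := w * α n) ⟨h2, by linarith⟩ hx
    (Metric.mem_closedBall_self (hh n).le)).trans_lt h4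
  rw [ENNReal.ofReal_lt_ofReal_iff (by linarith),
    Real.log_div (hq x _ hI).ne' (hq t _ hI).ne'] at h5
  rw [abs_lt] at *
  constructor <;> linarith [h3.1, h3.2, h5.1, h5.2]

/-- Bounds for the exceedance probabilities of the level `r ^ (-γ) * q (α n) t`. -/
theorem eventually_exceedance_mem_Icc {t : E} {κ : E → Measure ℝ}
    [∀ x, IsProbabilityMeasure (κ x)] {q : ℝ → E → ℝ} {γ c δ : ℝ}
    (hq : ∀ x : E, ∀ α ∈ Ioo (0 : ℝ) 1, 0 < q α x)
    (hκ : ∀ x : E, ∀ α ∈ Ioo (0 : ℝ) 1, cdf (κ x) (q α x) = 1 - α)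
    (hγ : 0 < γ) (hA : AssumptionA (fun α => q α t) γ)
    {h : ℕ → ℝ} (hh : ∀ n, 0 < h n) {m : ℕ → ℕ} (hm : Tendsto m atTop atTop)
    {α : ℕ → ℝ} (hα : ∀ n, α n ∈ Ioo (0 : ℝ) 1) (hα0 : Tendsto α atTop (𝓝 0)) (hc : 0 < c)
    (hmα : Tendsto (fun n => (m n : ℝ) * α n) atTop (𝓝 c)) (hδ : 0 < δ)
    (hosc : Tendsto (fun n => oscillation q t (h n) ((m n : ℝ) ^ (-(1 + δ)))) atTop (𝓝 0))
    {r : ℝ} (hr : 0 < r) {a b : ℝ} (ha : 0 < a) (har : a < c * r) (hrb : c * r < b) :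
    ∀ᶠ n in atTop, ∀ x ∈ Metric.closedBall t (h n),
      a / m n ≤ (κ x).real (Ioi (r ^ (-γ) * q (α n) t)) ∧
      (κ x).real (Ioi (r ^ (-γ) * q (α n) t)) ≤ b / m n := by
  -- Room around `r`: with u < r < v, the level lies between q(vα_n, x) and q(uα_n, x), so its tail
  -- probability lies between uα_n and vα_n.
  obtain ⟨u, hu1, hu2⟩ := exists_between ((div_lt_iff₀' hc).2 har)
  obtain ⟨v, hv1, hv2⟩ := exists_between ((lt_div_iff₀' hc).2 hrb)
  have hu0 : 0 < u := (div_pos ha hc).trans hu1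
  have hv0 : 0 < v := hr.trans hv1
  have hcu : a < u * c := by rwa [div_lt_iff₀ hc] at hu1
  have hcv : v * c < b := by rwa [lt_div_iff₀ hc] at hv2
  have hlu := mul_lt_mul_of_pos_left (Real.log_lt_log hu0 hu2) hγ
  have hlv := mul_lt_mul_of_pos_left (Real.log_lt_log hr hv1) hγ
  have htail : ∀ x z, (κ x).real (Ioi z) = 1 - cdf (κ x) z := by
    intro x z
    rw [cdf_eq_real, ← probReal_compl_eq_one_sub measurableSet_Iic, compl_Iic]
  filter_upwards [eventually_abs_log_quantile_lt hq hA hh hm hα hα0 hc hmα hδ hosc hu0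
      (sub_pos.2 hlu), eventually_abs_log_quantile_lt hq hA hh hm hα hα0 hc hmα hδ hosc hv0
      (sub_pos.2 hlv), (hmα.const_mul u).eventually (lt_mem_nhds hcu),
      (hmα.const_mul v).eventually (gt_mem_nhds hcv), hm.eventually (eventually_gt_atTop 0)]
    with n h1 h2 h3 h4 h5 x hx
  have hm0 : (0 : ℝ) < m n := by exact_mod_cast h5
  have hlog : Real.log (r ^ (-γ) * q (α n) t) = -γ * Real.log r + Real.log (q (α n) t) := by
    rw [Real.log_mul (Real.rpow_pos_of_pos hr _).ne' (hq t _ (hα n)).ne', Real.log_rpow hr]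
  have hz : 0 < r ^ (-γ) * q (α n) t := mul_pos (Real.rpow_pos_of_pos hr _) (hq t _ (hα n))
  rw [htail]
  constructor
  · have h6 : r ^ (-γ) * q (α n) t ≤ q (u * α n) x := by
      rw [← Real.log_le_log_iff hz (hq x _ h1.1), hlog]
      linarith [(abs_lt.1 (h1.2 x hx)).1]
    have h7 := monotone_cdf (κ x) h6
    rw [hκ x _ h1.1] at h7
    rw [div_le_iff₀ hm0]
    nlinarith
  · have h6 : q (v * α n) x ≤ r ^ (-γ) * q (α n) t := by
      rw [← Real.log_le_log_iff (hq x _ h2.1) hz, hlog]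
      linarith [(abs_lt.1 (h2.2 x hx)).2]
    have h7 := monotone_cdf (κ x) h6
    rw [hκ x _ h2.1] at h7
    rw [le_div_iff₀ hm0]
    nlinarith

/-! ### Poisson–Gamma duality and the limit law. -/

/-- The derivatives of the Poisson weights telescope, leaving minus the Gamma density of shape `k +
1`. -/
theorem hasDerivAt_poissonBelow_succ (k : ℕ) (x : ℝ) :
    HasDerivAt (poissonBelow (k + 1)) (-(x ^ k / k.factorial * Real.exp (-x))) x := by
  have hexp : HasDerivAt (fun x : ℝ => Real.exp (-x)) (-Real.exp (-x)) x := by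
    simpa using (hasDerivAt_neg x).exp
  induction k with
  | zero =>
    have : poissonBelow 1 = fun x => Real.exp (-x) := by
      ext y
      simp [poissonBelow]
    rw [this]
    simpa using hexp
  | succ k ih =>
    have : poissonBelow (k + 1 + 1) = fun y => poissonBelow (k + 1) y +
        y ^ (k + 1) / (k + 1).factorial * Real.exp (-y) := by
      ext y
      rw [poissonBelow, Finset.sum_range_succ]
      rfl
    rw [this]
    refine (ih.add ((((hasDerivAt_pow (k + 1) x).div_const _)).mul hexp)).congr_deriv ?_
    rw [Nat.factorial_succ]
    push_cast
    field_simp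
    simp

theorem tendsto_poissonBelow_atTop (k : ℕ) : Tendsto (poissonBelow k) atTop (𝓝 0) := by
  have : Tendsto (poissonBelow k) atTop (𝓝 (∑ j ∈ Finset.range k, (0 : ℝ))) := by
    refine tendsto_finsetSum _ fun j _ => ?_
    have := (Real.tendsto_pow_mul_exp_neg_atTop_nhds_zero j).div_const (j.factorial : ℝ)
    rw [zero_div] at this
    exact this.congr fun x => by ring
  simpa using this

theorem poissonBelow_pos {k : ℕ} (hk : 1 ≤ k) {r : ℝ} (hr : 0 < r) : 0 < poissonBelow k r :=
  Finset.sum_pos (fun j _ => by positivity) ⟨0, Finset.mem_range.2 hk⟩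

theorem poissonBelow_lt_one (k : ℕ) {r : ℝ} (hr : 0 < r) : poissonBelow k r < 1 := by
  have h1 := Real.sum_le_exp_of_nonneg hr.le (k + 1)
  rw [Finset.sum_range_succ] at h1
  have h2 : 0 < r ^ k / k.factorial := by positivity
  rw [poissonBelow, ← Finset.sum_mul]
  calc _ < Real.exp r * Real.exp (-r) := by gcongr; linarith
    _ = 1 := by rw [← Real.exp_add, add_neg_cancel, Real.exp_zero]

/-- The tail of the Gamma law with integer shape, in terms of the Poisson law. -/
theorem gammaMeasure_real_Ioi {k : ℕ} (hk : 1 ≤ k) {x : ℝ} (hx : 0 ≤ x) :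
    (gammaMeasure k 1).real (Ioi x) = poissonBelow k x := by
  obtain ⟨k, rfl⟩ : ∃ l, k = l + 1 := ⟨k - 1, by omega⟩
  have hk0 : (0 : ℝ) < ((k + 1 : ℕ) : ℝ) := by positivity
  have hpdf : ∀ y ∈ Ioi x, gammaPDFReal ((k + 1 : ℕ) : ℝ) 1 y
      = y ^ k / k.factorial * Real.exp (-y) := by
    intro y hy
    rw [gammaPDFReal, if_pos (hx.trans (le_of_lt hy))]
    push_cast
    rw [Real.one_rpow, Real.Gamma_nat_eq_factorial, add_sub_cancel_right, Real.rpow_natCast,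
      one_mul]
    ring
  have hder : ∀ y ∈ Ici x, HasDerivAt (fun y => -poissonBelow (k + 1) y)
      (y ^ k / k.factorial * Real.exp (-y)) y := fun y _ =>
    (hasDerivAt_poissonBelow_succ k y).neg.congr_deriv (neg_neg _)
  have hlim : Tendsto (fun y => -poissonBelow (k + 1) y) atTop (𝓝 0) := by
    simpa using (tendsto_poissonBelow_atTop (k + 1)).neg
  have hint := integral_Ioi_of_hasDerivAt_of_nonneg' hder (fun y hy => by
    have : 0 < y := hx.trans_lt hy
    positivity) hlim
  rw [zero_sub, neg_neg] at hint
  rw [measureReal_def, gammaMeasure, withDensity_apply _ measurableSet_Ioi, ← hint,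
    ← setIntegral_congr_fun measurableSet_Ioi hpdf, integral_eq_lintegral_of_nonneg_ae]
  · rfl
  · exact ae_of_all _ fun y => gammaPDFReal_nonneg hk0 one_pos y
  · exact (measurable_gammaPDFReal _ _).aestronglyMeasurable

/-- The limit law: the law of `(T / c) ^ (-γ) - 1` where `T` has the Gamma law with shape `k`
and rate `1`. -/
noncomputable def limitLaw (k : ℕ) (c γ : ℝ) : Measure ℝ :=
  (gammaMeasure k 1).map (fun T => (T / c) ^ (-γ) - 1)

theorem measurable_limitMap (c γ : ℝ) : Measurable (fun T : ℝ => (T / c) ^ (-γ) - 1) := by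
  fun_prop

theorem isProbabilityMeasure_limitLaw {k : ℕ} (hk : 1 ≤ k) (c γ : ℝ) :
    IsProbabilityMeasure (limitLaw k c γ) := by
  have : IsProbabilityMeasure (gammaMeasure k 1) :=
    isProbabilityMeasure_gammaMeasure (by exact_mod_cast hk) one_pos
  exact Measure.isProbabilityMeasure_map (measurable_limitMap c γ).aemeasurable

theorem ae_pos_gammaMeasure (k : ℕ) : ∀ᵐ T ∂(gammaMeasure k 1), 0 < T := by
  have h0 : gammaMeasure k 1 (Iic 0) = 0 := by
    rw [gammaMeasure, withDensity_apply _ measurableSet_Iic,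
      setLIntegral_congr (Iio_ae_eq_Iic (μ := volume)).symm, lintegral_gammaPDF_of_nonpos le_rfl]
  rw [ae_iff]
  simp only [not_lt]
  exact h0

/-- The map T ↦ (T/c)^(-γ) is decreasing, so the event is T ≥ cr, which is T > cr up to a null set.
-/
theorem limitLaw_real_Iic {k : ℕ} (hk : 1 ≤ k) {c γ r : ℝ} (hc : 0 < c) (hγ : 0 < γ)
    (hr : 0 < r) : (limitLaw k c γ).real (Iic (r ^ (-γ) - 1)) = poissonBelow k (c * r) := by
  rw [limitLaw, map_measureReal_apply (measurable_limitMap c γ) measurableSet_Iic,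
    ← gammaMeasure_real_Ioi hk (mul_pos hc hr).le]
  refine measureReal_congr ?_
  have hne : ∀ᵐ T ∂(gammaMeasure k 1), T ≠ c * r := by
    have hac : gammaMeasure k 1 ≪ volume := withDensity_absolutelyContinuous _ _
    exact hac.ae_le (Measure.ae_ne volume _)
  filter_upwards [ae_pos_gammaMeasure k, hne] with T hT hT'
  refine propext ?_
  change (T / c) ^ (-γ) - 1 ≤ r ^ (-γ) - 1 ↔ c * r < T
  rw [sub_le_sub_iff_right, Real.rpow_le_rpow_iff_of_neg (div_pos hT hc) hr (neg_lt_zero.2 hγ),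
    le_div_iff₀' hc]
  exact ⟨fun h => lt_of_le_of_ne h hT'.symm, le_of_lt⟩

theorem limitLaw_real_Iic_of_le (k : ℕ) {c γ y : ℝ} (hc : 0 < c) (hy : y ≤ -1) :
    (limitLaw k c γ).real (Iic y) = 0 := by
  rw [limitLaw, map_measureReal_apply (measurable_limitMap c γ) measurableSet_Iic,
    measureReal_def]
  have : gammaMeasure k 1 ((fun T : ℝ => (T / c) ^ (-γ) - 1) ⁻¹' Iic y) = 0 := by
    have h1 : ∀ᵐ T ∂(gammaMeasure k 1), ¬ ((T / c) ^ (-γ) - 1 ≤ y) := by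
      filter_upwards [ae_pos_gammaMeasure k] with T hT
      have := Real.rpow_pos_of_pos (div_pos hT hc) (-γ)
      linarith
    rw [ae_iff] at h1
    simp only [not_not] at h1
    exact h1
  rw [this, ENNReal.toReal_zero]

/-- The distribution function at 0 (the case r = 1) lies strictly between 0 and 1, impossible for a
point mass. -/
theorem limitLaw_ne_dirac {k : ℕ} (hk : 1 ≤ k) {c γ : ℝ} (hc : 0 < c) (hγ : 0 < γ) (a : ℝ) :
    limitLaw k c γ ≠ Measure.dirac a := by
  intro h
  have h1 := limitLaw_real_Iic hk hc hγ one_pos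
  rw [Real.one_rpow, sub_self, mul_one, h, measureReal_def,
    Measure.dirac_apply' _ measurableSet_Iic] at h1
  have h2 := poissonBelow_pos hk hc
  have h3 := poissonBelow_lt_one k hc
  by_cases ha : a ∈ Iic (0 : ℝ)
  · simp only [indicator_of_mem ha, Pi.one_apply, ENNReal.toReal_one] at h1
    linarith
  · simp only [indicator_of_notMem ha, ENNReal.toReal_zero] at h1
    linarith

/-! ### Convergence in distribution of the estimator. -/

/-- Convergence of distribution functions at every point implies convergence in distribution. -/
theorem tendstoInDistribution_of_tendsto_Iic {Ω : ℕ → Type*} [∀ n, MeasurableSpace (Ω n)]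
    {P : ∀ n, Measure (Ω n)} [∀ n, IsProbabilityMeasure (P n)] {X : ∀ n, Ω n → ℝ}
    {ν : Measure ℝ} [IsProbabilityMeasure ν] (hX : ∀ n, AEMeasurable (X n) (P n))
    (hlim : ∀ y, Tendsto (fun n => (P n).real {ω | X n ω ≤ y}) atTop (𝓝 (ν.real (Iic y)))) :
    TendstoInDistribution X atTop (id : ℝ → ℝ) P ν where
  forall_aemeasurable := hX
  aemeasurable_limit := aemeasurable_id
  tendsto := by
    -- Half-open intervals form a π-system containing small neighbourhoods of each point, and their
    -- masses are differences of distribution functions.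
    refine (isPiSystem_Ioc (id : ℝ → ℝ) id).tendsto_probabilityMeasure_of_tendsto_of_mem ?_ ?_ ?_
    · rintro s ⟨a, b, _, rfl⟩
      exact measurableSet_Ioc
    · intro u hu x hx
      obtain ⟨ε, hε, hsub⟩ := Metric.isOpen_iff.1 hu x hx
      refine ⟨Ioc (x - ε / 2) (x + ε / 2), ⟨x - ε / 2, x + ε / 2, by simp only [id]; linarith, rfl⟩,
        Ioc_mem_nhds (by linarith) (by linarith), fun z hz => hsub ?_⟩
      rw [Metric.mem_ball, Real.dist_eq, abs_lt]
      constructor <;> linarith [hz.1, hz.2]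
    · rintro s ⟨a, b, hab, rfl⟩
      have hIoc : ∀ (μ : Measure ℝ) [IsProbabilityMeasure μ],
          μ.real (Ioc a b) = μ.real (Iic b) - μ.real (Iic a) := by
        intro μ _
        have hab' : a ≤ b := le_of_lt hab
        rw [← Iic_sdiff_Iic, measureReal_sdiff (Iic_subset_Iic.2 hab') measurableSet_Iic]
      have hmap : ∀ n, IsProbabilityMeasure ((P n).map (X n)) := fun n =>
        Measure.isProbabilityMeasure_map (hX n)
      rw [← NNReal.tendsto_coe]
      have h1 : ∀ n, ((P n).map (X n)).real (Ioc a b)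
          = (P n).real {ω | X n ω ≤ b} - (P n).real {ω | X n ω ≤ a} := by
        intro n
        rw [hIoc, map_measureReal_apply_of_aemeasurable (hX n) measurableSet_Iic,
          map_measureReal_apply_of_aemeasurable (hX n) measurableSet_Iic]
        rfl
      have h2 : Tendsto (fun n => ((P n).map (X n)).real (Ioc a b)) atTop
          (𝓝 ((ν.map id).real (Ioc a b))) := by
        simp only [h1]
        rw [Measure.map_id, hIoc]
        exact (hlim b).sub (hlim a)
      exact h2

theorem aemeasurable_qHat {E Ω : Type*} [MetricSpace E] [MeasurableSpace Ω] {P : Measure Ω}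
    {n : ℕ} {Y : Fin n → Ω → ℝ} (hY : ∀ i, AEMeasurable (Y i) P) (x : Fin n → E) (t : E)
    (h α : ℝ) : AEMeasurable (fun ω => qHat x t h α (fun i => Y i ω)) P :=
  (measurable_orderStat _ _).comp_aemeasurable (aemeasurable_pi_lambda _ hY)

/-- With k = ⌊mα⌋, the zero-based index is m - k: k ≥ 1 keeps it in range, and α ≤ 1 gives k ≤ m, so
the subtraction is not truncated. -/
theorem qHat_le_iff {E : Type*} [MetricSpace E] {n : ℕ} (x : Fin n → E) (t : E) {h α : ℝ}
    (hα : α ≤ 1) (hk : 1 ≤ ⌊(sliceCard x t h : ℝ) * α⌋₊) (y : Fin n → ℝ) (z : ℝ) :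
    qHat x t h α y ≤ z ↔
      ((slice x t h).filter (fun i => z < y i)).card < ⌊(sliceCard x t h : ℝ) * α⌋₊ := by
  have hle : ⌊(sliceCard x t h : ℝ) * α⌋₊ ≤ sliceCard x t h := by
    refine Nat.floor_le_of_le ?_
    exact mul_le_of_le_one_right (Nat.cast_nonneg _) hα
  have hm : (slice x t h).card = sliceCard x t h := rfl
  rw [qHat, orderStat_le_iff _ _ (by omega), hm]
  omega

theorem tendsto_measureReal_qHat_le {E : Type*} [MetricSpace E] {t : E} {κ : E → Measure ℝ}
    [∀ x, IsProbabilityMeasure (κ x)] {q : ℝ → E → ℝ} {γ c δ : ℝ}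
    (hq : ∀ x : E, ∀ α ∈ Ioo (0 : ℝ) 1, 0 < q α x)
    (hκ : ∀ x : E, ∀ α ∈ Ioo (0 : ℝ) 1, cdf (κ x) (q α x) = 1 - α)
    (hγ : 0 < γ) (hA : AssumptionA (fun α => q α t) γ) {x : ∀ n : ℕ, Fin n → E}
    {Ω : ℕ → Type*} [∀ n, MeasurableSpace (Ω n)] {P : ∀ n, Measure (Ω n)}
    [∀ n, IsProbabilityMeasure (P n)] {Y : ∀ n : ℕ, Fin n → Ω n → ℝ}
    (hY : ∀ n, iIndepFun (Y n) (P n)) (hlaw : ∀ n i, HasLaw (Y n i) (κ (x n i)) (P n))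
    {h : ℕ → ℝ} (hh : ∀ n, 0 < h n)
    {α : ℕ → ℝ} (hα : ∀ n, α n ∈ Ioo (0 : ℝ) 1) (hα0 : Tendsto α atTop (𝓝 0)) (hc : 1 ≤ c)
    (hmα : Tendsto (fun n => (sliceCard (x n) t (h n) : ℝ) * α n) atTop (𝓝 c))
    (hfl : Tendsto (fun n => ⌊(sliceCard (x n) t (h n) : ℝ) * α n⌋₊) atTop (𝓝 ⌊c⌋₊))
    (hδ : 0 < δ)
    (hosc : Tendsto (fun n => oscillation q t (h n)
      ((sliceCard (x n) t (h n) : ℝ) ^ (-(1 + δ)))) atTop (𝓝 0)) (y : ℝ) :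
    Tendsto (fun n => (P n).real
        {ω | qHat (x n) t (h n) (α n) (fun i => Y n i ω) / q (α n) t - 1 ≤ y}) atTop
      (𝓝 ((limitLaw ⌊c⌋₊ c γ).real (Iic y))) := by
  have hc0 : 0 < c := one_pos.trans_le hc
  have hk : 1 ≤ ⌊c⌋₊ := Nat.le_floor (by simpa using hc)
  have hm : Tendsto (fun n => sliceCard (x n) t (h n)) atTop atTop := by
    have hα0' : Tendsto α atTop (𝓝[>] 0) :=
      tendsto_nhdsWithin_iff.2 ⟨hα0, Eventually.of_forall fun n => (hα n).1⟩
    have h1 := hmα.pos_mul_atTop hc0 hα0'.inv_tendsto_nhdsGT_zero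
    rw [← tendsto_natCast_atTop_iff (R := ℝ)]
    refine h1.congr fun n => ?_
    rw [Pi.inv_apply, mul_assoc, mul_inv_cancel₀ (hα n).1.ne', mul_one]
  -- Convergence in ℕ means eventual equality, so the rank is eventually ⌊c⌋.
  rw [nhds_discrete, tendsto_pure] at hfl
  have hmain : ∀ r : ℝ, 0 < r → Tendsto (fun n => (P n).real
        {ω | qHat (x n) t (h n) (α n) (fun i => Y n i ω) / q (α n) t - 1 ≤ r ^ (-γ) - 1}) atTop
      (𝓝 (poissonBelow ⌊c⌋₊ (c * r))) := by
    intro r hr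
    have hlim := tendsto_measureReal_card_filter_lt hY (fun n i => (hlaw n i).aemeasurable)
      (fun n => slice (x n) t (h n)) (fun n => r ^ (-γ) * q (α n) t) ⌊c⌋₊ (mul_pos hc0 hr) hm ?_
    · refine hlim.congr' ?_
      filter_upwards [hfl] with n hn
      congr 1
      ext ω
      simp only [mem_ofPred_eq]
      rw [sub_le_sub_iff_right, div_le_iff₀ (hq t _ (hα n)),
        qHat_le_iff (x n) t (hα n).2.le (by rw [hn]; exact hk), hn]
    · intro a b ha har hrb
      filter_upwards [eventually_exceedance_mem_Icc hq hκ hγ hA hh hm hα hα0 hc0 hmα hδ hosc hr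
        ha har hrb] with n hn i hi
      have hi' : x n i ∈ Metric.closedBall t (h n) := by
        classical
        exact (Finset.mem_filter.1 hi).2
      have hP : (P n).real {ω | r ^ (-γ) * q (α n) t < Y n i ω}
          = (κ (x n i)).real (Ioi (r ^ (-γ) * q (α n) t)) := by
        rw [measureReal_def, measureReal_def]
        exact congrArg ENNReal.toReal ((hlaw n i).measure_eq measurableSet_Ioi)
      rw [hP]
      exact hn _ hi'
  rcases lt_or_ge (-1) y with hy | hy
  · have hr : 0 < (1 + y) ^ (-γ⁻¹) := Real.rpow_pos_of_pos (by linarith) _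
    have hry : ((1 + y) ^ (-γ⁻¹)) ^ (-γ) - 1 = y := by
      rw [← Real.rpow_mul (by linarith), neg_mul_neg, inv_mul_cancel₀ hγ.ne', Real.rpow_one]
      ring
    have := hmain _ hr
    rwa [← limitLaw_real_Iic hk hc0 hγ hr, hry] at this
  · rw [limitLaw_real_Iic_of_le _ hc0 hy]
    rw [tendsto_order]
    refine ⟨fun v hv => Eventually.of_forall fun n => hv.trans_le measureReal_nonneg,
      fun v hv => ?_⟩
    -- For y ≤ -1 the event lies in the one at r^(-γ) - 1 for every r > 0, whose limiting
    -- probability vanishes as r → ∞.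
    have htop : Tendsto (fun r => poissonBelow ⌊c⌋₊ (c * r)) atTop (𝓝 0) :=
      (tendsto_poissonBelow_atTop _).comp (tendsto_id.const_mul_atTop hc0)
    obtain ⟨r, hrv, hr⟩ := ((htop.eventually (gt_mem_nhds hv)).and (eventually_gt_atTop 0)).exists
    filter_upwards [(hmain r hr).eventually (gt_mem_nhds hrv)] with n hn
    refine (measureReal_mono fun ω hω => ?_).trans_lt hn
    have : (0 : ℝ) < r ^ (-γ) := Real.rpow_pos_of_pos hr _
    simp only [mem_ofPred_eq] at hω ⊢
    linarith

/-- If the distribution functions of `X n - 1` have a positive limit at a negative point, then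
`X n` does not converge to `1` in probability. -/
theorem not_convergesInProbability_one {Ω : ℕ → Type*} [∀ n, MeasurableSpace (Ω n)]
    {P : ∀ n, Measure (Ω n)} [∀ n, IsProbabilityMeasure (P n)] {X : ∀ n, Ω n → ℝ} {y p : ℝ}
    (hy : y < 0) (hp : 0 < p)
    (hlim : Tendsto (fun n => (P n).real {ω | X n ω - 1 ≤ y}) atTop (𝓝 p)) :
    ¬ ConvergesInProbability P X 1 := by
  intro hX
  have h1 := (ENNReal.tendsto_toReal ENNReal.zero_ne_top).comp (hX (-y) (by linarith))
  refine hp.not_ge (le_of_tendsto_of_tendsto' hlim h1 fun n => ?_)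
  refine measureReal_mono fun ω hω => ?_
  simp only [mem_ofPred_eq] at hω ⊢
  rw [abs_of_neg (by linarith)]
  linarith

end ExtremeQuantile

theorem theorem2 (c γ : ℝ) (hc : 1 ≤ c) (hγ : 0 < γ) :
    -- the limit law depends on `c` and `γ = γ(t)` only, and it is not a point mass
    ∃ (𝓔 : Measure ℝ) (_ : IsProbabilityMeasure 𝓔), (∀ a : ℝ, 𝓔 ≠ Measure.dirac a) ∧
      ∀ (E : Type*) [MetricSpace E] (t : E)
        -- conditional law `κ x` of the response given the covariate `x`, and its quantiles
        (κ : E → Measure ℝ) [∀ x, IsProbabilityMeasure (κ x)] (q : ℝ → E → ℝ)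
        (_ : ∀ x : E, ∀ α ∈ Ioo (0 : ℝ) 1, 0 < q α x)
        (_ : ∀ x : E, ∀ α ∈ Ioo (0 : ℝ) 1, cdf (κ x) (q α x) = 1 - α)
        (_ : ExtremeQuantile.AssumptionA (fun α => q α t) γ)
        -- non-random design points and independent responses, for each sample size `n`
        (x : ∀ n : ℕ, Fin n → E)
        (Ω : ℕ → Type*) [∀ n, MeasurableSpace (Ω n)]
        (P : ∀ n, Measure (Ω n)) [∀ n, IsProbabilityMeasure (P n)]
        (Y : ∀ n : ℕ, Fin n → Ω n → ℝ)
        (_ : ∀ n, iIndepFun (Y n) (P n))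
        (_ : ∀ n i, HasLaw (Y n i) (κ (x n i)) (P n))
        -- the bandwidth
        (h : ℕ → ℝ) (_ : ∀ n, 0 < h n) (_ : Tendsto h atTop (𝓝 0))
        -- the orders `α n`, with `m n` the number of observations in the window
        (m : ℕ → ℕ) (_ : ∀ n, m n = ExtremeQuantile.sliceCard (x n) t (h n))
        (α : ℕ → ℝ) (_ : ∀ n, α n ∈ Ioo (0 : ℝ) 1)
        (_ : Tendsto α atTop (𝓝 0))
        (_ : Tendsto (fun n => (m n : ℝ) * α n) atTop (𝓝 c))
        (_ : Tendsto (fun n => ⌊(m n : ℝ) * α n⌋₊) atTop (𝓝 ⌊c⌋₊))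
        -- the oscillation condition
        (δ : ℝ) (_ : 0 < δ)
        (_ : Tendsto (fun n => ExtremeQuantile.oscillation q t (h n)
          ((m n : ℝ) ^ (-(1 + δ)))) atTop (𝓝 0)),
        TendstoInDistribution
            (fun n ω => ExtremeQuantile.qHat (x n) t (h n) (α n) (fun i => Y n i ω)
              / q (α n) t - 1)
            atTop (id : ℝ → ℝ) P 𝓔 ∧
          ¬ ExtremeQuantile.ConvergesInProbability P
            (fun n ω => ExtremeQuantile.qHat (x n) t (h n) (α n) (fun i => Y n i ω)
              / q (α n) t) 1 := by
  have hc0 : 0 < c := one_pos.trans_le hc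
  have hk : 1 ≤ ⌊c⌋₊ := Nat.le_floor (by simpa using hc)
  have hprob := ExtremeQuantile.isProbabilityMeasure_limitLaw hk c γ
  refine ⟨ExtremeQuantile.limitLaw ⌊c⌋₊ c γ, hprob,
    ExtremeQuantile.limitLaw_ne_dirac hk hc0 hγ, ?_⟩
  intro E _ t κ _ q hq hκ hA x Ω _ P _ Y hY hlaw h hh _ m hm α hα hα0 hmα hfl δ hδ hosc
  obtain rfl : m = fun n => ExtremeQuantile.sliceCard (x n) t (h n) := funext hm
  have hlim := ExtremeQuantile.tendsto_measureReal_qHat_le hq hκ hγ hA hY hlaw hh hα hα0 hc hmα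
    hfl hδ hosc
  refine ⟨ExtremeQuantile.tendstoInDistribution_of_tendsto_Iic (fun n => ?_) hlim, ?_⟩
  · exact ((ExtremeQuantile.aemeasurable_qHat (fun i => (hlaw n i).aemeasurable) _ _ _ _).div_const
      _).sub_const _
  -- Any r > 1 gives a negative point with positive limiting mass to its left; r = 2 is used.
  · have h2 : (2 : ℝ) ^ (-γ) - 1 < 0 :=
      sub_neg.2 (Real.rpow_lt_one_of_one_lt_of_neg one_lt_two (neg_lt_zero.2 hγ))
    refine ExtremeQuantile.not_convergesInProbability_one h2 ?_ (hlim _)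
    rw [ExtremeQuantile.limitLaw_real_Iic hk hc0 hγ two_pos]
    exact ExtremeQuantile.poissonBelow_pos hk (by positivity)
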